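/- Let $V$ be a finite-dimensional real vector space, let $W$ be a finite group generated by reflections of $V$, let $\mathcal A$ be its reflection arrangement (the set of fixed hyperplanes of the reflections in $W$), and let $k$ be a field whose characteristic does not divide $|W|$. Let $\mathcal F$ be the monoid of faces of $\mathcal A$ (the product $xy$ has sign $\sigma_H(x)$ at $H\in\mathcal A$ if this is non-zero, and $\sigma_H(y)$ otherwise), let $\mathcal L$ be the intersection lattice, i.e. the set of supports of faces ordered by inclusion, where $\operatorname{supp}(x)$ is the intersection of all hyperplanes of $\mathcal A$ containing $x$, and let $A=(k\mathcal F)^W$ be the subalgebra of $W$-invariant elements of $k\mathcal F$. For each $X\in\mathcal L$ let $\ell_X\in k\mathcal F$ be a linear combination of faces of support $X$ with coefficients summing to $1$, such that $w(\ell_X)=\ell_{w(X)}$ for all $w\in W$. Define recursively $e_X=\ell_X-\sum_{Y>X}\ell_X e_Y$, and put $\varepsilon_{\mathcal O}=\sum_{X\in\mathcal O}e_X\in A$ for each $\mathcal O\in\mathcal L/W$. The quiver $\Gamma$ of $A$ has the set $\mathcal L/W$ of orbits as its vertex set, and the number of its arrows from $\mathcal O'$ to $\mathcal O$ is $\dim_k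 \varepsilon_{\mathcal O}\big(\operatorname{rad}(A)/\operatorname{rad}^2(A)\big)\varepsilon_{\mathcal O'}$. 1. There are no arrows in $\Gamma$ starting at the vertex $\mathcal O_V=\{V\}$. The same holds if the quiver is computed with any other complete system $(e_v)_v$ of primitive orthogonal idempotents of $A$: no arrow starts at a vertex $u$ with $Ae_u\cong A\varepsilon_{\mathcal O_V}$ as left $A$-modules. 2. Let $\mathcal Q$ be the quiver with vertex set $\mathcal L$ and exactly one arrow $X\to Y$ if $X$ covers $Y$ in $\mathcal L$, and no other arrows. Fix an orientation on each $X\in\mathcal L$, let $\sigma_X(w)$ be $1$ if $w$ maps the orientation of $X$ to that of $w(X)$ and $-1$ otherwise, and let $w\in W$ act linearly on the path algebra $k\mathcal Q$ by $$w(X_0\to\cdots\to X_t)=\sigma_{X_0}(w)\,\sigma_{X_t}(w)\,\big(w(X_0)\to\cdots\to w(X_t)\big).$$ If $P=(X_0\to X_1\to\cdots\to X_l)$ is a path in $\mathcal Q$ with $X_0=V$ and $l\ge 1$, then $W$ contains exactly one reflection $s$ with fixed hyperplane $X_1$, and $s(P)=-P$. -/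

import Mathlib

open scoped BigOperators

noncomputable section

namespace FaceAlgebra

section Quivers

variable (k : Type*) [Field k] {A : Type*} [Ring A] [Algebra k A]

/-- An idempotent is primitive if it is non-zero and is not the sum of two non-zero orthogonal
idempotents. -/
def IsPrimitive (e : A) : Prop :=
  IsIdempotentElem e ∧ e ≠ 0 ∧
    ∀ f g : A, IsIdempotentElem f → IsIdempotentElem g → f * g = 0 → g * f = 0 → e = f + g →
      f = 0 ∨ g = 0

/-- A complete system of primitive orthogonal idempotents. -/
def IsCompleteSystem {ι : Type*} [Fintype ι] (e : ι → A) : Prop :=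
  CompleteOrthogonalIdempotents e ∧ ∀ i, IsPrimitive (e i)

/-- The subspace `f (rad A / rad² A) e` of `A / rad² A`. -/
def arrowSpace (e f : A) : Submodule k (A ⧸ (Ring.jacobson A * Ring.jacobson A : Ideal A)) :=
  ((Ring.jacobson A).restrictScalars k).map
    (((Ring.jacobson A * Ring.jacobson A : Ideal A).mkQ.restrictScalars k).comp
      ((LinearMap.mulLeft k f).comp (LinearMap.mulRight k e)))

/-- The number of arrows from the vertex `u` to the vertex `v` in the quiver of the (finite
dimensional) algebra `A`, computed with the family of idempotents `e`. -/
def numArrows {ι : Type*} (e : ι → A) (u v : ι) : ℕ :=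
  Module.finrank k (arrowSpace k (e u) (e v))

end Quivers

variable {V : Type*} [AddCommGroup V] [Module ℝ V]

/-- `s` is a reflection of `V` whose fixed hyperplane is `H`. -/
def IsReflectionIn (s : V ≃ₗ[ℝ] V) (H : Submodule ℝ V) : Prop :=
  ∃ (f : Module.Dual ℝ V) (α : V) (h : f α = 2), s = Module.reflection h ∧ LinearMap.ker f = H

/-- `W` is generated by reflections of `V`. The finite Coxeter groups are the finite `W` with this
property. -/
def IsGeneratedByReflections (W : Subgroup (V ≃ₗ[ℝ] V)) : Prop :=
  Subgroup.closure {s | s ∈ W ∧ ∃ H, IsReflectionIn s H} = W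

/-- The reflection arrangement of `W`. -/
def arrangement (W : Subgroup (V ≃ₗ[ℝ] V)) : Set (Submodule ℝ V) :=
  {H | ∃ s ∈ W, IsReflectionIn s H}

variable (W : Subgroup (V ≃ₗ[ℝ] V))

/-- A linear form with kernel `H`; it names the two open half spaces `H⁺` (where the form is
positive) and `H⁻` (where it is negative). -/
def form (H : arrangement W) : Module.Dual ℝ V := H.2.choose_spec.2.choose

variable {W}

lemma ker_form (H : arrangement W) : LinearMap.ker (form W H) = H.1 :=
  H.2.choose_spec.2.choose_spec.choose_spec.choose_spec.2

lemma IsReflectionIn.mem_iff {s : V ≃ₗ[ℝ] V} {H : Submodule ℝ V} (h : IsReflectionIn s H) (v : V) :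
    v ∈ H ↔ s v = v := by
  obtain ⟨f, α, hf, rfl, rfl⟩ := h
  have hα : α ≠ 0 := by rintro rfl; simp at hf
  rw [Module.reflection_apply, LinearMap.mem_ker, sub_eq_self, smul_eq_zero, or_iff_left hα]

instance finite_arrangement [Finite W] : Finite (arrangement W) := by
  choose s hs h using fun H : arrangement W => H.2
  refine Finite.of_injective (β := W) (fun H => ⟨s H, hs H⟩) fun H K hHK => ?_
  have e : s H = s K := congrArg Subtype.val hHK
  ext v
  rw [(h H).mem_iff, (h K).mem_iff, e]

/-- `W` permutes the arrangement. -/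
lemma map_mem_arrangement (w : W) {H : Submodule ℝ V} (hH : H ∈ arrangement W) :
    H.comap (w : V ≃ₗ[ℝ] V).toLinearMap ∈ arrangement W := by
  obtain ⟨s, hs, f, α, hf, rfl, rfl⟩ := hH
  refine ⟨(w : V ≃ₗ[ℝ] V)⁻¹ * Module.reflection hf * w,
    W.mul_mem (W.mul_mem (W.inv_mem w.2) hs) w.2,
    f ∘ₗ (w : V ≃ₗ[ℝ] V).toLinearMap, (w : V ≃ₗ[ℝ] V).symm α, by simpa using hf, ?_, ?_⟩
  · ext v
    change (w : V ≃ₗ[ℝ] V).symm (Module.reflection hf ((w : V ≃ₗ[ℝ] V) v)) = _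
    simp [Module.reflection_apply]
  · rw [LinearMap.ker_comp]

lemma form_comp (w : W) (H : arrangement W) :
    ∃ (c : SignType) (K : arrangement W), c ≠ 0 ∧
      ∀ v, SignType.sign (form W H ((w : V ≃ₗ[ℝ] V) v)) = c * SignType.sign (form W K v) := by
  let K : arrangement W := ⟨_, map_mem_arrangement w H.2⟩
  have hker : LinearMap.ker (form W K) =
      LinearMap.ker (form W H ∘ₗ (w : V ≃ₗ[ℝ] V).toLinearMap) := by
    rw [ker_form, LinearMap.ker_comp, ker_form]
  have hmem : form W H ∘ₗ (w : V ≃ₗ[ℝ] V).toLinearMap ∈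
      Submodule.span ℝ (Set.range fun _ : Unit => form W K) := by
    apply mem_span_of_iInf_ker_le_ker
    simp [hker]
  rw [Set.range_const, Submodule.mem_span_singleton] at hmem
  obtain ⟨a, ha⟩ := hmem
  have key : ∀ v, form W H ((w : V ≃ₗ[ℝ] V) v) = a * form W K v := fun v => by
    simpa using (LinearMap.congr_fun ha v).symm
  refine ⟨SignType.sign a, K, ?_, fun v => by rw [key, sign_mul]⟩
  rw [Ne, sign_eq_zero_iff]
  rintro rfl
  obtain ⟨s, -, f, α, hf, -, hH⟩ := H.2
  have h1 : α ∈ H.1 := by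
    rw [← ker_form, LinearMap.mem_ker]
    simpa using key ((w : V ≃ₗ[ℝ] V).symm α)
  rw [← hH, LinearMap.mem_ker, hf] at h1
  norm_num at h1

variable (W)

/-- A face of the arrangement: a non-empty intersection of sets `H^σ_H`. It is stored as its sign
sequence, which determines it and is determined by it; the set itself is `Face.carrier`. -/
@[ext]
structure Face where
  /-- The sign sequence of the face. -/
  sign : arrangement W → SignType
  nonempty : ∃ v : V, ∀ H, SignType.sign (form W H v) = sign H

variable {W}

namespace Face

/-- The face as a subset of `V`. -/
def carrier (x : Face W) : Set V := {v | ∀ H, SignType.sign (form W H v) = x.sign H}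

/-- The support of a face: the intersection of the hyperplanes of the arrangement that
contain it. -/
def supp (x : Face W) : Submodule ℝ V := sInf {H | H ∈ arrangement W ∧ x.carrier ⊆ H}

lemma subset_iff (x : Face W) (H : arrangement W) :
    x.carrier ⊆ (H : Submodule ℝ V) ↔ x.sign H = 0 := by
  constructor
  · intro h
    obtain ⟨v, hv⟩ := x.nonempty
    have := h hv
    rw [SetLike.mem_coe, ← ker_form, LinearMap.mem_ker] at this
    rw [← hv, this, sign_zero]
  · intro h v hv
    rw [SetLike.mem_coe, ← ker_form, LinearMap.mem_ker, ← sign_eq_zero_iff, hv H, h]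

lemma mem_supp (x : Face W) (v : V) : v ∈ x.supp ↔ ∀ H : arrangement W, x.sign H = 0 → v ∈ H.1 := by
  simp only [supp, Submodule.mem_sInf, Set.mem_ofPred_eq]
  exact ⟨fun h H hH => h H ⟨H.2, (x.subset_iff H).2 hH⟩,
    fun h H hH => h ⟨H, hH.1⟩ ((x.subset_iff ⟨H, hH.1⟩).1 hH.2)⟩

instance [Finite W] : Finite (Face W) :=
  Finite.of_injective Face.sign fun _ _ h => Face.ext h

/-- The product of two faces. -/
instance [Finite W] : Mul (Face W) where
  mul x y :=
    { sign := fun H => if x.sign H ≠ 0 then x.sign H else y.sign H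
      nonempty := by
        obtain ⟨u, hu⟩ := x.nonempty
        obtain ⟨v, hv⟩ := y.nonempty
        have ev : ∀ H : arrangement W, ∀ᶠ t in nhdsWithin (0 : ℝ) (Set.Ioi 0),
            SignType.sign (form W H (u + t • v)) =
              if x.sign H ≠ 0 then x.sign H else y.sign H := by
          intro H
          rw [← hu H, ← hv H]
          have hc : Filter.Tendsto (fun t : ℝ => form W H (u + t • v))
              (nhdsWithin 0 (Set.Ioi 0)) (nhds (form W H u)) := by
            have : Continuous fun t : ℝ => form W H u + t * form W H v := by fun_prop
            simpa using (this.tendsto 0).mono_left nhdsWithin_le_nhds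
          rcases lt_trichotomy (form W H u) 0 with h | h | h
          · filter_upwards [hc.eventually_lt_const h] with t ht
            rw [sign_neg h, sign_neg ht]
            simp
          · filter_upwards [self_mem_nhdsWithin] with t ht
            have ht' : 0 < t := ht
            simp [h, sign_mul, sign_pos ht']
          · filter_upwards [hc.eventually_const_lt h] with t ht
            rw [sign_pos h, sign_pos ht]
            simp
        obtain ⟨t, ht⟩ := (Filter.eventually_all.2 ev).exists
        exact ⟨u + t • v, ht⟩ }

lemma mul_sign [Finite W] (x y : Face W) (H : arrangement W) :
    (x * y).sign H = if x.sign H ≠ 0 then x.sign H else y.sign H := rfl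

/-- The faces form a monoid; the identity is the intersection of all hyperplanes. -/
instance [Finite W] : Monoid (Face W) where
  one := ⟨fun _ => 0, 0, fun H => by simp⟩
  mul_assoc x y z := by
    ext H
    simp only [mul_sign]
    split_ifs <;> simp_all
  one_mul x := by
    ext H
    change (if (0 : SignType) ≠ 0 then (0 : SignType) else x.sign H) = x.sign H
    simp
  mul_one x := by
    ext H
    change (if x.sign H ≠ 0 then x.sign H else 0) = x.sign H
    split_ifs with h
    · rfl
    · exact (not_not.1 h).symm

/-- The action of `W` on faces, given by images of sets; see `Face.carrier_smul`. -/
instance : SMul W (Face W) where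
  smul w x := ⟨fun H => SignType.sign (form W H ((w : V ≃ₗ[ℝ] V) x.nonempty.choose)),
    _, fun _ => rfl⟩

lemma smul_sign (w : W) (H : arrangement W) :
    ∃ (c : SignType) (K : arrangement W), c ≠ 0 ∧
      (∀ x : Face W, (w • x).sign H = c * x.sign K) ∧
      ∀ v, SignType.sign (form W H ((w : V ≃ₗ[ℝ] V) v)) = c * SignType.sign (form W K v) := by
  obtain ⟨c, K, hc, h⟩ := form_comp w H
  refine ⟨c, K, hc, fun x => ?_, h⟩
  rw [← x.nonempty.choose_spec K, ← h]
  rfl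

lemma apply_mem_smul (w : W) {x : Face W} {v : V} (hv : v ∈ x.carrier) :
    (w : V ≃ₗ[ℝ] V) v ∈ (w • x).carrier := by
  intro H
  obtain ⟨c, K, -, h1, h2⟩ := smul_sign w H
  rw [h1, h2, hv K]

lemma ext_of_mem {x y : Face W} {v : V} (hx : v ∈ x.carrier) (hy : v ∈ y.carrier) : x = y := by
  ext H
  rw [← hx H, ← hy H]

instance : MulAction W (Face W) where
  one_smul x := by
    obtain ⟨v, hv⟩ := x.nonempty
    exact ext_of_mem (apply_mem_smul 1 hv) hv
  mul_smul a b x := by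
    obtain ⟨v, hv⟩ := x.nonempty
    exact ext_of_mem (apply_mem_smul (a * b) hv) (apply_mem_smul a (apply_mem_smul b hv))

lemma carrier_smul (w : W) (x : Face W) :
    (w • x).carrier = (w : V ≃ₗ[ℝ] V) '' x.carrier := by
  ext v
  constructor
  · intro hv
    refine ⟨((w⁻¹ : W) : V ≃ₗ[ℝ] V) v, ?_, (w : V ≃ₗ[ℝ] V).apply_symm_apply v⟩
    simpa using apply_mem_smul w⁻¹ hv
  · rintro ⟨u, hu, rfl⟩
    exact apply_mem_smul w hu

instance [Finite W] : MulDistribMulAction W (Face W) where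
  smul_mul w x y := by
    ext H
    obtain ⟨c, K, hc, h, -⟩ := smul_sign w H
    rw [mul_sign, h, h, h, mul_sign]
    by_cases hx : x.sign K = 0 <;> simp [hx, hc]
  smul_one w := by
    ext H
    obtain ⟨c, K, hc, h, -⟩ := smul_sign w H
    rw [h]
    change c * 0 = 0
    simp

lemma le_supp_smul (w : W) {x : Face W} {v : V} (hv : v ∈ x.supp) :
    (w : V ≃ₗ[ℝ] V) v ∈ (w • x).supp := by
  rw [mem_supp] at hv ⊢
  intro H hH
  obtain ⟨c, K, hc, h1, h2⟩ := smul_sign w H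
  rw [h1, mul_eq_zero, or_iff_right hc] at hH
  have h3 := hv K hH
  rw [← ker_form, LinearMap.mem_ker] at h3 ⊢
  rw [← sign_eq_zero_iff, h2, h3, sign_zero, mul_zero]

lemma supp_smul (w : W) (x : Face W) :
    (w • x).supp = x.supp.map (w : V ≃ₗ[ℝ] V).toLinearMap := by
  ext v
  constructor
  · intro hv
    refine ⟨((w⁻¹ : W) : V ≃ₗ[ℝ] V) v, ?_, (w : V ≃ₗ[ℝ] V).apply_symm_apply v⟩
    simpa using le_supp_smul w⁻¹ hv
  · rintro ⟨u, hu, rfl⟩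
    exact le_supp_smul w hu

end Face

variable (W)

/-- The intersection lattice: the set of supports of faces, ordered by inclusion. -/
abbrev Flat : Type _ := {X : Submodule ℝ V // ∃ x : Face W, x.supp = X}

variable {W}

namespace Flat

instance [Finite W] : Finite (Flat W) :=
  inferInstanceAs (Finite (Set.range (Face.supp (W := W))))

instance [Finite W] : Fintype (Flat W) := Fintype.ofFinite _

/-- The action of `W` on the intersection lattice by images of subspaces. -/
instance : MulAction W (Flat W) where
  smul w X := ⟨X.1.map (w : V ≃ₗ[ℝ] V).toLinearMap, by
    obtain ⟨x, hx⟩ := X.2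
    exact ⟨w • x, by rw [Face.supp_smul, hx]⟩⟩
  one_smul X := by
    apply Subtype.ext
    change X.1.map ((1 : V ≃ₗ[ℝ] V)).toLinearMap = X.1
    exact Submodule.map_id _
  mul_smul a b X := by
    apply Subtype.ext
    change X.1.map ((a : V ≃ₗ[ℝ] V) * (b : V ≃ₗ[ℝ] V)).toLinearMap = (X.1.map _).map _
    rw [← Submodule.map_comp]
    rfl

lemma smul_val (w : W) (X : Flat W) : (w • X).1 = X.1.map (w : V ≃ₗ[ℝ] V).toLinearMap := rfl

lemma smul_le_smul (w : W) {X Y : Flat W} (h : X ≤ Y) : w • X ≤ w • Y :=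
  Submodule.map_mono (f := (w : V ≃ₗ[ℝ] V).toLinearMap) h

/-- The order automorphism of the intersection lattice given by `w`. -/
def smulIso (w : W) : Flat W ≃o Flat W where
  toEquiv := MulAction.toPerm w
  map_rel_iff' {X Y} := ⟨fun h => by simpa using smul_le_smul w⁻¹ h, smul_le_smul w⟩

variable (W)

/-- The ambient space `V` as an element of the intersection lattice. -/
def ambient [Finite W] : Flat W := ⟨⊤, by
  have hfin : (arrangement W).Finite := Set.toFinite _
  have htop : ⊤ ∉ hfin.toFinset := by
    rw [Set.Finite.mem_toFinset]
    rintro ⟨s, -, f, α, hf, -, hH⟩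
    have : α ∈ LinearMap.ker f := hH ▸ Submodule.mem_top
    rw [LinearMap.mem_ker, hf] at this
    norm_num at this
  have := Subspace.biUnion_ne_univ_of_top_notMem htop
  obtain ⟨v, hv⟩ := (Set.ne_univ_iff_exists_notMem _).1 this
  refine ⟨⟨fun H => SignType.sign (form W H v), v, fun _ => rfl⟩, ?_⟩
  rw [eq_top_iff]
  intro u _
  rw [Face.mem_supp]
  intro H hH
  rw [sign_eq_zero_iff, ← LinearMap.mem_ker, ker_form] at hH
  exact (hv (Set.mem_biUnion (by simp : H.1 ∈ (hfin.toFinset : Set (Submodule ℝ V))) hH)).elim⟩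

/-- The `W`-orbits of elements of the intersection lattice. -/
abbrev Orbits : Type _ := MulAction.orbitRel.Quotient W (Flat W)

/-- The `W`-orbit of an element of the intersection lattice. -/
def orbit (X : Flat W) : Orbits W := Quotient.mk _ X

end Flat

open Flat

section Algebra

variable (k : Type*) [Field k] (W) [Finite W]

/-- The face semigroup algebra `kF`. -/
abbrev FaceAlg : Type _ := MonoidAlgebra k (Face W)

/-- The linear action of `W` on the face semigroup algebra. -/
def act (w : W) : FaceAlg W k →ₐ[k] FaceAlg W k :=
  MonoidAlgebra.mapDomainAlgHom k k (MulDistribMulAction.toMonoidHom (Face W) w)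

/-- The `W`-invariant subalgebra `(kF)^W`. -/
def invariants : Subalgebra k (FaceAlg W k) :=
  ⨅ w : W, AlgHom.equalizer (act W k w) (AlgHom.id k (FaceAlg W k))

lemma mem_invariants (a : FaceAlg W k) : a ∈ invariants W k ↔ ∀ w : W, act W k w a = a := by
  simp [invariants, Algebra.mem_iInf]

/-- A choice, for each `X` in the intersection lattice, of a linear combination `ℓ_X` of faces of
support `X` whose coefficients sum to `1`, such that `w(ℓ_X) = ℓ_{w(X)}`. -/
structure InvariantFamily where
  /-- The elements `ℓ_X`. -/
  ell : Flat W → FaceAlg W k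
  supp_eq : ∀ (X : Flat W) (x : Face W), (ell X).coeff x ≠ 0 → x.supp = X.1
  sum_eq_one : ∀ X : Flat W, ((ell X).coeff.sum fun _ a => a) = 1
  act_ell : ∀ (w : W) (X : Flat W), act W k w (ell X) = ell (w • X)

variable {W k}

namespace InvariantFamily

variable (L : InvariantFamily W k)

/-- The elements `e_X` of `kF`, given by `e_X = ℓ_X - ∑_{Y > X} ℓ_X e_Y`. -/
def e : Flat W → FaceAlg W k :=
  (wellFounded_gt (α := Flat W)).fix fun X rec =>
    open scoped Classical in L.ell X - ∑ Y : {Y : Flat W // X < Y}, L.ell X * rec Y.1 Y.2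

lemma e_eq (X : Flat W) : L.e X =
    open scoped Classical in L.ell X - ∑ Y : {Y : Flat W // X < Y}, L.ell X * L.e Y.1 := by
  rw [e, WellFounded.fix_eq]

lemma act_e (w : W) (X : Flat W) : act W k w (L.e X) = L.e (w • X) := by
  classical
  induction X using (wellFounded_gt (α := Flat W)).induction with
  | _ X ih =>
    rw [e_eq, e_eq, map_sub, map_sum, L.act_ell]
    congr 1
    refine Fintype.sum_equiv
      ((smulIso w).toEquiv.subtypeEquiv fun Y => ((smulIso w).lt_iff_lt (x := X) (y := Y)).symm)
      _ _ fun Y => ?_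
    rw [map_mul, L.act_ell, ih Y.1 Y.2]
    rfl

/-- The idempotents `ε_O = ∑_{X ∈ O} e_X` of the invariant subalgebra, one for each orbit `O`. -/
def eps (O : Orbits W) : invariants W k :=
  ⟨open scoped Classical in ∑ X : Flat W, if orbit W X = O then L.e X else 0, by
    classical
    rw [mem_invariants]
    intro w
    rw [map_sum]
    refine Fintype.sum_equiv (smulIso w).toEquiv _ _ fun X => ?_
    have h : orbit W (w • X) = orbit W X :=
      Quotient.sound (MulAction.orbitRel_apply.2 (MulAction.mem_orbit X w))
    change act W k w _ = if orbit W (w • X) = O then L.e (w • X) else 0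
    rw [h, ← L.act_e]
    split_ifs <;> simp⟩

end InvariantFamily

end Algebra

section Paths

variable (W)

/-- A path `X_0 → X_1 → ⋯ → X_l` in the quiver on the intersection lattice which has exactly one
arrow `X → Y` if `X` covers `Y` and no other arrows. -/
abbrev QPath : Type _ := RelSeries {p : Flat W × Flat W | p.2 ⋖ p.1}

variable {W}

/-- The path `w(X_0) → ⋯ → w(X_l)`. -/
def QPath.image (w : W) (P : QPath W) : QPath W :=
  P.map ⟨fun X => w • X, fun {_ _} h => (apply_covBy_apply_iff (smulIso w)).2 h⟩

variable (W) in
/-- A choice of an orientation on each subspace in the intersection lattice. -/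
abbrev Orientations : Type _ :=
  ∀ X : Flat W, Orientation ℝ X.1 (Fin (Module.finrank ℝ X.1))

/-- The restriction of `w` to an isomorphism of `X` onto `w(X)`. -/
def restr (w : W) (X : Flat W) : X.1 ≃ₗ[ℝ] (w • X).1 :=
  (w : V ≃ₗ[ℝ] V).submoduleMap X.1

open scoped Classical in
/-- The number `σ_X(w)`: it is `1` if `w` maps the chosen orientation of `X` to that of `w(X)` and
`-1` otherwise. -/
def sigma (o : Orientations W) (w : W) (X : Flat W) : ℤˣ :=
  if Orientation.reindex ℝ (w • X).1 (finCongr (restr w X).finrank_eq)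
    (Orientation.map _ (restr w X) (o X)) = o (w • X) then 1 else -1

variable (k : Type*) [Field k]

/-- The action of `w` on the path algebra (as a vector space, with the paths as a basis):
`w(X_0 → ⋯ → X_l) = σ_{X_0}(w) σ_{X_l}(w) (w(X_0) → ⋯ → w(X_l))`. -/
def pathAct (o : Orientations W) (w : W) : (QPath W →₀ k) →ₗ[k] (QPath W →₀ k) :=
  Finsupp.linearCombination k fun P : QPath W =>
    Finsupp.single (P.image w) (((sigma o w P.head * sigma o w P.last : ℤˣ) : ℤ) : k)

end Paths

end FaceAlgebra

end

open FaceAlgebra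

open FaceAlgebra

noncomputable section

/-! For `V` the sum over the orbit and the recursion collapse, so `ε_{O_V} = ℓ_V`, an invariant
combination of chambers. A chamber absorbs every factor to its right, and a face times a chamber is
a chamber. Hence `ℓ_V` is idempotent, and `a ℓ_V` is an invariant combination of chambers for each
`a ∈ A`. Since `W` permutes the chambers transitively, such combinations form a line, so `A ℓ_V = k
ℓ_V`. The radical acts on this line by scalars; a non-zero scalar would put the idempotent `ℓ_V` in
the radical. Thus `rad(A) ℓ_V = 0`, and no arrow starts at `O_V`. The condition `rad(A) e = 0`
depends only on the isomorphism class of `Ae`, which covers other systems of idempotents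
(`jacobson_mul_eps_ambient`, `jacobson_mul_eq_zero_of_equiv`).

For a path from `V`, the vertex `X_1` is a hyperplane of the arrangement. Its reflection fixes
`X_1`, hence every later vertex, pointwise, but reverses the orientation of `V`. Uniqueness holds
because an invariant inner product determines the root line (`IsReflectionIn.unique`). -/

namespace FaceAlgebra

/-! ### Reflections in a finite group. -/

section Reflections

variable {V : Type*} [AddCommGroup V] [Module ℝ V]

/-- A positive definite symmetric bilinear form invariant under the finite group `W`. -/
lemma exists_invariant_form [FiniteDimensional ℝ V] (W : Subgroup (V ≃ₗ[ℝ] V)) [Finite W] :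
    ∃ B : V →ₗ[ℝ] V →ₗ[ℝ] ℝ, (∀ v, v ≠ 0 → 0 < B v v) ∧
      ∀ w ∈ W, ∀ x y, B (w x) (w y) = B x y := by
  have := Fintype.ofFinite W
  let b := Module.finBasis ℝ V
  let B₀ : V →ₗ[ℝ] V →ₗ[ℝ] ℝ := ∑ i, (b.coord i).smulRight (b.coord i)
  have hB₀ : ∀ x y, B₀ x y = ∑ i, b.coord i x * b.coord i y := fun x y => by
    simp [B₀, LinearMap.sum_apply]
  have hpos : ∀ v, v ≠ 0 → 0 < B₀ v v := fun v hv => by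
    rw [hB₀]
    obtain ⟨i, hi⟩ : ∃ i, b.coord i v ≠ 0 := by
      by_contra! h
      exact hv (b.forall_coord_eq_zero_iff.1 h)
    exact Finset.sum_pos' (fun j _ => mul_self_nonneg _)
      ⟨i, Finset.mem_univ i, mul_self_pos.2 hi⟩
  refine ⟨∑ w : W, B₀.compl₁₂ (w : V ≃ₗ[ℝ] V).toLinearMap (w : V ≃ₗ[ℝ] V).toLinearMap,
    fun v hv => ?_, fun w hw x y => ?_⟩
  · simp only [LinearMap.sum_apply, LinearMap.compl₁₂_apply, LinearEquiv.coe_coe]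
    exact Finset.sum_pos (fun w _ => hpos _ fun h => hv ((LinearEquiv.map_eq_zero_iff _).1 h))
      Finset.univ_nonempty
  · simp only [LinearMap.sum_apply, LinearMap.compl₁₂_apply, LinearEquiv.coe_coe]
    exact Fintype.sum_equiv (Equiv.mulRight (⟨w, hw⟩ : W)) _ _ fun u => rfl

/-- The root of a reflection is orthogonal to its hyperplane for every invariant form. -/
lemma apply_root_of_invariant {f : Module.Dual ℝ V} {α : V} (h : f α = 2)
    {B : V →ₗ[ℝ] V →ₗ[ℝ] ℝ}
    (hB : ∀ x y, B (Module.reflection h x) (Module.reflection h y) = B x y) (x : V) :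
    2 * B x α = f x * B α α := by
  -- The reflection sends `α` to `-α`, so invariance reads `B (x - f x • α) (-α) = B x α`.
  have := hB x α
  simp only [Module.reflection_apply, h, map_sub, map_smul, LinearMap.sub_apply,
    LinearMap.smul_apply, smul_eq_mul] at this
  linarith

/-- A finite group contains at most one reflection with a given hyperplane. -/
lemma IsReflectionIn.unique [FiniteDimensional ℝ V] {W : Subgroup (V ≃ₗ[ℝ] V)} [Finite W]
    {s t : V ≃ₗ[ℝ] V} (hs : s ∈ W) (ht : t ∈ W) {H : Submodule ℝ V}
    (hsH : IsReflectionIn s H) (htH : IsReflectionIn t H) : s = t := by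
  obtain ⟨B, hpos, hB⟩ := exists_invariant_form W
  obtain ⟨f, α, hf, rfl, hfH⟩ := hsH
  obtain ⟨g, β, hg, rfl, hgH⟩ := htH
  have h1 := apply_root_of_invariant hf (hB _ hs)
  have h2 := apply_root_of_invariant hg (hB _ ht)
  have hgβ : ∀ x, f x * g β = g x * f β := fun x => by
    have hx : g β • x - g x • β ∈ LinearMap.ker f := by
      rw [hfH, ← hgH]
      simp [mul_comm]
    have := LinearMap.mem_ker.1 hx
    simp only [map_sub, map_smul, smul_eq_mul] at this
    linarith
  rw [hg] at hgβ
  have hfβ : f β ≠ 0 := fun h0 => by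
    have := hgβ α
    rw [h0, hf] at this
    norm_num at this
  -- The difference `d` is killed by `f` and `g`, hence orthogonal to both roots; being a
  -- combination of them it is orthogonal to itself, so it vanishes.
  have hαβ : f β • α = (2 : ℝ) • β := by
    by_contra hne
    set d := f β • α - (2 : ℝ) • β with hd
    have hfd : f d = 0 := by simp [hd, hf, mul_comm]
    have hgd : g d = 0 := by
      have := hgβ d
      rw [hfd, zero_mul, zero_eq_mul] at this
      exact this.resolve_right hfβ
    have hd0 := hpos d (sub_ne_zero.2 hne)
    have e1 := h1 d
    have e2 := h2 d
    rw [hfd] at e1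
    rw [hgd] at e2
    have key : ∀ y, B y d = f β * B y α - 2 * B y β := fun y => by simp [hd]
    have e3 : B d α = 0 := by linarith
    have e4 : B d β = 0 := by linarith
    rw [key, e3, e4] at hd0
    simp at hd0
  ext x
  rw [Module.reflection_apply, Module.reflection_apply]
  congr 1
  have hβα : β = (f β / 2) • α := by
    rw [div_eq_inv_mul, mul_smul, hαβ, smul_smul]
    norm_num
  have hx := hgβ x
  have : f x = g x * (f β / 2) := by linarith
  rw [this, mul_smul, ← hβα]

lemma IsReflectionIn.det_eq [FiniteDimensional ℝ V] {s : V ≃ₗ[ℝ] V} {H : Submodule ℝ V}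
    (h : IsReflectionIn s H) : LinearMap.det (s : V →ₗ[ℝ] V) = -1 := by
  obtain ⟨f, α, hf, rfl, -⟩ := h
  have : ((Module.reflection hf : V ≃ₗ[ℝ] V) : V →ₗ[ℝ] V) = LinearMap.transvection f (-α) := by
    ext x
    simp [Module.reflection_apply, LinearMap.transvection.apply, sub_eq_add_neg]
  rw [this, LinearMap.transvection.det, map_neg, hf]
  norm_num

lemma ne_top_of_mem_arrangement {W : Subgroup (V ≃ₗ[ℝ] V)} {H : Submodule ℝ V}
    (h : H ∈ arrangement W) : H ≠ ⊤ := by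
  obtain ⟨s, -, f, α, hf, -, rfl⟩ := h
  intro htop
  have : α ∈ LinearMap.ker f := htop ▸ Submodule.mem_top
  rw [LinearMap.mem_ker, hf] at this
  norm_num at this

lemma eq_of_le_of_mem_arrangement {W : Subgroup (V ≃ₗ[ℝ] V)} {H K : Submodule ℝ V}
    (hH : H ∈ arrangement W) (hK : K ∈ arrangement W) (h : H ≤ K) : H = K := by
  have hco : IsCoatom H := by
    obtain ⟨s, -, f, α, hf, -, rfl⟩ := hH
    apply LinearMap.isCoatom_ker_of_surjective
    refine LinearMap.surjective ?_
    rintro rfl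
    simp at hf
  exact ((hco.le_iff.1 h).resolve_left (ne_top_of_mem_arrangement hK)).symm

end Reflections

/-! ### Chambers and hyperplanes in the intersection lattice. -/

section Chambers

variable {V : Type*} [AddCommGroup V] [Module ℝ V] {W : Subgroup (V ≃ₗ[ℝ] V)}

lemma Face.supp_eq_top_iff (x : Face W) : x.supp = ⊤ ↔ ∀ H, x.sign H ≠ 0 := by
  constructor
  · intro h H hH
    refine ne_top_of_mem_arrangement H.2 (eq_top_iff.2 fun v _ => ?_)
    exact (x.mem_supp v).1 (h ▸ Submodule.mem_top) H hH
  · intro h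
    exact eq_top_iff.2 fun v _ => (x.mem_supp v).2 fun H hH => (h H hH).elim

/-- `W` acts transitively on the chambers. -/
lemma Face.exists_smul_eq_of_supp_eq_top [FiniteDimensional ℝ V] [Finite W] {x y : Face W}
    (hx : x.supp = ⊤) (hy : y.supp = ⊤) : ∃ w : W, w • x = y := by
  rw [supp_eq_top_iff] at hx hy
  obtain ⟨B, hpos, hB⟩ := exists_invariant_form W
  obtain ⟨u, hu⟩ := x.nonempty
  obtain ⟨v, hv⟩ := y.nonempty
  -- No hyperplane separates this maximiser `w u` from `v`: reflecting in a separating one would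
  -- increase `B v`.
  obtain ⟨w, hw⟩ := Finite.exists_max fun w : W => B v ((w : V ≃ₗ[ℝ] V) u)
  refine ⟨w, ext_of_mem (apply_mem_smul w hu) (v := (w : V ≃ₗ[ℝ] V) u) fun H => ?_⟩
  obtain ⟨s, hs, f, α, hf, rfl, hH⟩ := H.2
  have hα : 0 < B α α := hpos α (by rintro rfl; simp at hf)
  set u' := (w : V ≃ₗ[ℝ] V) u with hu'
  have hmax := hw (⟨_, hs⟩ * w)
  change B v (Module.reflection hf u') ≤ B v u' at hmax
  rw [Module.reflection_apply, map_sub, map_smul, smul_eq_mul] at hmax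
  have h1 := apply_root_of_invariant hf (hB _ hs) v
  have h2 : 0 ≤ f u' * f v := by
    have : 0 ≤ (f u' * f v) * B α α := by
      have : (f u' * f v) * B α α = 2 * (f u' * B v α) := by rw [mul_assoc, ← h1]; ring
      linarith
    exact nonneg_of_mul_nonneg_left this hα
  -- Signs are measured by `form W H` rather than `f`. Both have kernel `H`, and the ratio enters
  -- below only through its square.
  obtain ⟨c, hc⟩ : ∃ c : ℝ, f = c • form W H := by
    have hmem : f ∈ Submodule.span ℝ (Set.range fun _ : Unit => form W H) := by
      apply mem_span_of_iInf_ker_le_ker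
      simp [hH, ker_form]
    rw [Set.range_const, Submodule.mem_span_singleton] at hmem
    obtain ⟨a, ha⟩ := hmem
    exact ⟨a, ha.symm⟩
  have hc0 : c ≠ 0 := by
    rintro rfl
    simp [hc] at hf
  have hvH : form W H v ≠ 0 := by
    rw [← sign_ne_zero, hv]
    exact hy H
  have huH : form W H u' ≠ 0 := by
    have := apply_mem_smul w hu H
    rw [← sign_ne_zero, this]
    obtain ⟨c, K, hc, h, -⟩ := smul_sign w H
    rw [h]
    exact mul_ne_zero hc (hx K)
  have h3 : 0 < form W H u' * form W H v := by
    refine lt_of_le_of_ne ?_ (mul_ne_zero huH hvH).symm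
    have : f u' * f v = c ^ 2 * (form W H u' * form W H v) := by
      rw [hc]; simp only [LinearMap.smul_apply, smul_eq_mul]; ring
    rw [this] at h2
    exact nonneg_of_mul_nonneg_right h2 (by positivity)
  rw [← hv]
  rcases pos_and_pos_or_neg_and_neg_of_mul_pos h3 with ⟨a, b⟩ | ⟨a, b⟩
  · rw [sign_pos a, sign_pos b]
  · rw [sign_neg a, sign_neg b]

/-- Every hyperplane of the arrangement belongs to the intersection lattice. -/
lemma exists_supp_eq_of_mem_arrangement [Finite W] {H : Submodule ℝ V}
    (hH : H ∈ arrangement W) : ∃ x : Face W, x.supp = H := by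
  -- The other hyperplanes cut `H` in finitely many proper subspaces, which cannot cover it; a point
  -- of `H` outside them lies in a face of support `H`.
  have hfin : (((fun K : Submodule ℝ V => K.comap H.subtype) '' (arrangement W \ {H}))).Finite :=
    ((Set.toFinite (arrangement W)).sdiff).image _
  have htop : ⊤ ∉ hfin.toFinset := by
    rw [Set.Finite.mem_toFinset]
    rintro ⟨K, ⟨hK, hne⟩, h⟩
    exact hne (eq_of_le_of_mem_arrangement hH hK (Submodule.comap_subtype_eq_top.1 h)).symm
  obtain ⟨v, hv⟩ := (Set.ne_univ_iff_exists_notMem _).1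
    (Subspace.biUnion_ne_univ_of_top_notMem htop)
  have hvK : ∀ K : arrangement W, (v : V) ∈ K.1 ↔ K.1 = H := fun K => by
    refine ⟨fun h => ?_, fun h => h ▸ v.2⟩
    by_contra hne
    refine hv (Set.mem_biUnion (x := K.1.comap H.subtype) ?_ h)
    rw [Finset.mem_coe, Set.Finite.mem_toFinset]
    exact ⟨K.1, ⟨K.2, hne⟩, rfl⟩
  refine ⟨⟨fun K => SignType.sign (form W K v), v, fun _ => rfl⟩, ?_⟩
  ext u
  simp only [Face.mem_supp, sign_eq_zero_iff, ← LinearMap.mem_ker, ker_form, hvK]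
  exact ⟨fun h => h ⟨H, hH⟩ rfl, fun h K hK => hK ▸ h⟩

/-- A proper support lies in some hyperplane of the arrangement, itself a support strictly below
`V`; covering leaves no room between the two. -/
lemma Flat.mem_arrangement_of_covBy_ambient [Finite W] {X : Flat W} (h : X ⋖ Flat.ambient W) :
    X.1 ∈ arrangement W := by
  obtain ⟨x, hx⟩ := X.2
  have hne : x.supp ≠ ⊤ := fun ht => h.lt.ne (Subtype.ext (hx.symm.trans ht))
  rw [Ne, Face.supp_eq_top_iff] at hne
  push Not at hne
  obtain ⟨H, hH⟩ := hne
  let Y : Flat W := ⟨H.1, exists_supp_eq_of_mem_arrangement H.2⟩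
  have hXY : X ≤ Y := fun v hv => by
    rw [← hx, x.mem_supp] at hv
    exact hv H hH
  have hY : Y < Flat.ambient W :=
    lt_of_le_of_ne (le_top (a := H.1)) fun e =>
      ne_top_of_mem_arrangement H.2 (congrArg Subtype.val e)
  rcases hXY.eq_or_lt with e | hlt
  · rw [e]
    exact H.2
  · exact (h.2 hlt hY).elim

end Chambers

/-! ### The signs `σ_X(w)` as signs of determinants. -/

section Orientation

variable {V : Type*} [AddCommGroup V] [Module ℝ V] [FiniteDimensional ℝ V]
  {W : Subgroup (V ≃ₗ[ℝ] V)}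

/-- Keeping `Y` a variable in place of `w • X` allows substitution along `h`, after which both
orientations live on the same space. -/
lemma reindex_map_orientation_eq_iff (o : Orientations W) {X Y : Flat W} (h : Y = X)
    (e : X.1 ≃ₗ[ℝ] Y.1) :
    Orientation.reindex ℝ Y.1 (finCongr e.finrank_eq) (Orientation.map _ e (o X)) = o Y ↔
      0 < LinearMap.det
        ((e.trans (LinearEquiv.ofEq _ _ (congrArg Subtype.val h)) : X.1 ≃ₗ[ℝ] X.1) :
          X.1 →ₗ[ℝ] X.1) := by
  subst h
  rw [finCongr_refl, Orientation.reindex_refl, Equiv.refl_apply]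
  exact Orientation.map_eq_iff_det_pos _ _ (by simp)

lemma sigma_eq_one_of_forall_apply_eq (o : Orientations W) {w : W} {X : Flat W} (h : w • X = X)
    (hw : ∀ v ∈ X.1, (w : V ≃ₗ[ℝ] V) v = v) : sigma o w X = 1 := by
  rw [sigma, if_pos]
  rw [reindex_map_orientation_eq_iff o h]
  have : ((restr w X).trans (LinearEquiv.ofEq _ _ (congrArg Subtype.val h))).toLinearMap =
      LinearMap.id := by
    ext v
    exact hw v v.2
  rw [this, LinearMap.det_id]
  exact one_pos

lemma sigma_eq_neg_one_of_isReflectionIn (o : Orientations W) {w : W} {X : Flat W}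
    (hX : X.1 = ⊤) (h : w • X = X) {H : Submodule ℝ V}
    (hw : IsReflectionIn (w : V ≃ₗ[ℝ] V) H) : sigma o w X = -1 := by
  rw [sigma, if_neg]
  rw [reindex_map_orientation_eq_iff o h, not_lt]
  -- Conjugation by `e` turns the restriction of `w` to `⊤` into `w` itself, whose determinant is
  -- `-1`.
  let e : X.1 ≃ₗ[ℝ] V := LinearEquiv.ofTop X.1 hX
  rw [← LinearMap.det_conj _ e]
  have : (e : X.1 →ₗ[ℝ] V) ∘ₗ
      ((restr w X).trans (LinearEquiv.ofEq _ _ (congrArg Subtype.val h))).toLinearMap ∘ₗ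
        (e.symm : V →ₗ[ℝ] X.1) = (w : V ≃ₗ[ℝ] V).toLinearMap := by
    ext v
    rfl
  rw [this, hw.det_eq]
  norm_num

end Orientation

/-! ### Idempotents annihilated by the radical. -/

section Radical

/-- For `e` in the radical `1 - e` has a left inverse `z`; multiplying `z * (1 - e) = 1` by `e` on
the right gives `0 = e`. -/
lemma _root_.IsIdempotentElem.eq_zero_of_mem_jacobson {A : Type*} [Ring A] {e : A}
    (he : IsIdempotentElem e) (h : e ∈ Ring.jacobson A) : e = 0 := by
  rw [← Ideal.jacobson_bot, Ideal.mem_jacobson_iff] at h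
  obtain ⟨z, hz⟩ := h (-1)
  rw [Ideal.mem_bot] at hz
  have h1 : (z * -1 * e + z - 1) * e = -(z * (e * e)) + z * e - e := by noncomm_ring
  rw [hz, zero_mul, he.eq] at h1
  simpa using h1.symm

/-- The source idempotent acts on the right, so `e v * (a * e u)` vanishes even before passing to
the quotient by the squared radical. -/
lemma numArrows_eq_zero_of_jacobson_mul_eq_zero (k : Type*) [Field k] {A : Type*} [Ring A]
    [Algebra k A] {ι : Type*} (e : ι → A) {u : ι}
    (h : ∀ a ∈ Ring.jacobson A, a * e u = 0) (v : ι) : numArrows k e u v = 0 := by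
  have : arrowSpace k (e u) (e v) = ⊥ := by
    rw [arrowSpace, eq_bot_iff]
    rintro _ ⟨a, ha, rfl⟩
    rw [Submodule.mem_bot, LinearMap.comp_apply, LinearMap.comp_apply, LinearMap.mulRight_apply,
      h a ha, map_zero, map_zero]
  rw [numArrows, this, finrank_bot]

/-- A radical element acting on `e` by a non-zero scalar would force `e` into the radical. -/
lemma jacobson_mul_eq_zero_of_mul_mem_span {k A : Type*} [Field k] [Ring A] [Algebra k A] {e : A}
    (he : IsIdempotentElem e) (h : ∀ a, ∃ c : k, a * e = c • e) :
    ∀ a ∈ Ring.jacobson A, a * e = 0 := by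
  intro a ha
  obtain ⟨c, hc⟩ := h a
  have hmem : c • e ∈ Ring.jacobson A := hc ▸ Ideal.mul_mem_right _ _ ha
  rcases eq_or_ne c 0 with rfl | h0
  · rw [hc, zero_smul]
  · have : e ∈ Ring.jacobson A := by
      have := Ideal.mul_mem_left (Ring.jacobson A) (algebraMap k A c⁻¹) hmem
      rwa [← Algebra.smul_def, smul_smul, inv_mul_cancel₀ h0, one_smul] at this
    rw [he.eq_zero_of_mem_jacobson this, mul_zero]

/-- Annihilation by the radical depends only on the isomorphism class of a principal left
ideal. -/
lemma jacobson_mul_eq_zero_of_equiv {A : Type*} [Ring A] {e f : A}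
    (φ : Submodule.span A {f} ≃ₗ[A] Submodule.span A {e})
    (h : ∀ a ∈ Ring.jacobson A, a * e = 0) : ∀ a ∈ Ring.jacobson A, a * f = 0 := by
  intro a ha
  let x : Submodule.span A {f} := ⟨f, Submodule.mem_span_singleton_self f⟩
  obtain ⟨b, hb⟩ := Submodule.mem_span_singleton.1 (φ x).2
  -- Here `φ x = b * e`, and `a * b` stays in the radical, which is two-sided.
  have h1 : a • φ x = 0 := by
    apply Subtype.ext
    rw [Submodule.coe_smul, ← hb, smul_smul, smul_eq_mul, h _ (Ideal.mul_mem_right _ _ ha)]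
    rfl
  rw [← map_smul, LinearEquiv.map_eq_zero_iff] at h1
  exact congrArg Subtype.val h1

end Radical

/-! ### Combinations of chambers and the idempotent of `V`. -/

section Chambers

variable {V : Type*} [AddCommGroup V] [Module ℝ V] {W : Subgroup (V ≃ₗ[ℝ] V)} [Finite W]

lemma Face.mul_eq_left {x : Face W} (hx : x.supp = ⊤) (y : Face W) : x * y = x := by
  rw [supp_eq_top_iff] at hx
  ext H
  rw [mul_sign, if_pos (hx H)]

lemma Face.supp_mul_eq_top (x : Face W) {y : Face W} (hy : y.supp = ⊤) : (x * y).supp = ⊤ := by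
  rw [supp_eq_top_iff] at hy ⊢
  intro H
  rw [mul_sign]
  split_ifs with h
  · exact h
  · exact hy H

variable {k : Type*} [Field k]

lemma coeff_act_smul (w : W) (a : FaceAlg W k) (x : Face W) :
    (act W k w a).coeff (w • x) = a.coeff x :=
  Finsupp.mapDomain_apply (MulAction.injective w) a.coeff x

lemma supp_eq_top_of_coeff_mul_ne_zero {a b : FaceAlg W k}
    (hb : ∀ x, b.coeff x ≠ 0 → x.supp = ⊤) {x : Face W} (h : (a * b).coeff x ≠ 0) :
    x.supp = ⊤ := by
  classical
  rw [MonoidAlgebra.coeff_mul] at h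
  obtain ⟨y, -, hy⟩ := Finset.exists_ne_zero_of_sum_ne_zero h
  obtain ⟨z, hz, hyz⟩ := Finset.exists_ne_zero_of_sum_ne_zero hy
  rw [← (ite_ne_right_iff.1 hyz).1]
  exact y.supp_mul_eq_top (hb z (Finsupp.mem_support_iff.1 hz))

/-- A combination of chambers with coefficients summing to `1` is idempotent. -/
lemma isIdempotentElem_of_forall_supp_eq_top {a : FaceAlg W k}
    (ha : ∀ x, a.coeff x ≠ 0 → x.supp = ⊤) (hs : (a.coeff.sum fun _ c => c) = 1) :
    IsIdempotentElem a := by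
  classical
  ext x
  rw [MonoidAlgebra.coeff_mul]
  -- As `y * z = y` for a chamber `y`, the inner sum is `a.coeff y` times the total coefficient `1`.
  have : ∀ y ∈ a.coeff.support, (a.coeff.sum fun z c =>
      if y * z = x then a.coeff y * c else 0) = if y = x then a.coeff y else 0 := by
    intro y hy
    simp only [Face.mul_eq_left (ha y (Finsupp.mem_support_iff.1 hy))]
    split_ifs
    · rw [← Finsupp.mul_sum, hs, mul_one]
    · simp
  rw [Finsupp.sum, Finset.sum_congr rfl this, Finset.sum_ite_eq']
  simp +contextual

/-- The invariant combinations of chambers form a line. -/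
lemma exists_eq_smul_of_forall_supp_eq_top [FiniteDimensional ℝ V] {a b : FaceAlg W k}
    (ha : a ∈ invariants W k) (hb : b ∈ invariants W k) (ha0 : a ≠ 0)
    (hac : ∀ x, a.coeff x ≠ 0 → x.supp = ⊤) (hbc : ∀ x, b.coeff x ≠ 0 → x.supp = ⊤) :
    ∃ c : k, b = c • a := by
  rw [mem_invariants] at ha hb
  obtain ⟨x, hx⟩ : ∃ x, a.coeff x ≠ 0 := by
    by_contra! h
    exact ha0 (MonoidAlgebra.ext (Finsupp.ext h))
  -- Invariant coefficients are constant on the single orbit of chambers, so the ratio at one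
  -- chamber serves for all.
  refine ⟨b.coeff x / a.coeff x, ?_⟩
  ext y
  rw [MonoidAlgebra.coeff_smul, Finsupp.smul_apply, smul_eq_mul]
  by_cases hy : y.supp = ⊤
  · obtain ⟨w, rfl⟩ := Face.exists_smul_eq_of_supp_eq_top (hac x hx) hy
    have h1 := coeff_act_smul w a x
    have h2 := coeff_act_smul w b x
    rw [ha] at h1
    rw [hb] at h2
    rw [h1, h2, div_mul_cancel₀ _ hx]
  · rw [not_not.1 (mt (hac y) hy), not_not.1 (mt (hbc y) hy), mul_zero]

namespace InvariantFamily

variable (L : InvariantFamily W k)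

lemma e_ambient : L.e (Flat.ambient W) = L.ell (Flat.ambient W) := by
  classical
  have : IsEmpty {Y : Flat W // Flat.ambient W < Y} :=
    ⟨fun Y => not_le_of_gt Y.2 (le_top (a := Y.1.1))⟩
  rw [e_eq, Finset.univ_eq_empty, Finset.sum_empty, sub_zero]

lemma coe_eps_ambient : (L.eps (Flat.orbit W (Flat.ambient W)) : FaceAlg W k) =
    L.ell (Flat.ambient W) := by
  classical
  have h : ∀ X : Flat W, Flat.orbit W X = Flat.orbit W (Flat.ambient W) ↔
      X = Flat.ambient W := by
    refine fun X => ⟨fun hX => ?_, fun hX => hX ▸ rfl⟩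
    obtain ⟨w, rfl⟩ := MulAction.orbitRel_apply.1 (Quotient.exact hX)
    apply Subtype.ext
    exact Submodule.map_top _ |>.trans (LinearEquiv.range _)
  change (∑ X : Flat W, if Flat.orbit W X = Flat.orbit W (Flat.ambient W) then L.e X else 0) = _
  simp only [h, Finset.sum_ite_eq', Finset.mem_univ, if_true]
  exact L.e_ambient

lemma ell_ne_zero (X : Flat W) : L.ell X ≠ 0 := by
  intro h
  have := L.sum_eq_one X
  rw [h] at this
  simp at this

/-- The radical annihilates the idempotent of the orbit of the ambient space. -/
lemma jacobson_mul_eps_ambient [FiniteDimensional ℝ V] :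
    ∀ a ∈ Ring.jacobson (invariants W k), a * L.eps (Flat.orbit W (Flat.ambient W)) = 0 := by
  have hsupp : ∀ x, (L.ell (Flat.ambient W)).coeff x ≠ 0 → x.supp = ⊤ :=
    fun x => L.supp_eq (Flat.ambient W) x
  have hmem : L.ell (Flat.ambient W) ∈ invariants W k := L.coe_eps_ambient ▸ Subtype.property _
  refine jacobson_mul_eq_zero_of_mul_mem_span (k := k) ?_ fun a => ?_
  · apply Subtype.ext
    rw [MulMemClass.coe_mul, coe_eps_ambient]
    exact isIdempotentElem_of_forall_supp_eq_top hsupp (L.sum_eq_one _)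
  · obtain ⟨c, hc⟩ := exists_eq_smul_of_forall_supp_eq_top hmem (mul_mem a.2 hmem)
      (L.ell_ne_zero _) hsupp fun x => supp_eq_top_of_coeff_mul_ne_zero hsupp
    refine ⟨c, Subtype.ext ?_⟩
    rw [MulMemClass.coe_mul, SetLike.val_smul, coe_eps_ambient, hc]

end InvariantFamily

end Chambers

/-! ### Paths starting at `V`. -/

section Paths

variable {V : Type*} [AddCommGroup V] [Module ℝ V] {W : Subgroup (V ≃ₗ[ℝ] V)}

lemma Flat.smul_eq_of_forall_apply_eq {w : W} {X : Flat W}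
    (h : ∀ v ∈ X.1, (w : V ≃ₗ[ℝ] V) v = v) : w • X = X := by
  apply Subtype.ext
  rw [Flat.smul_val]
  ext v
  constructor
  · rintro ⟨u, hu, rfl⟩
    rw [LinearEquiv.coe_coe, h u hu]
    exact hu
  · exact fun hv => ⟨v, hv, h v hv⟩

lemma Flat.smul_ambient [Finite W] (w : W) : w • Flat.ambient W = Flat.ambient W :=
  Subtype.ext ((Submodule.map_top _).trans (LinearEquiv.range _))

lemma QPath.antitone (P : QPath W) : Antitone P :=
  Fin.antitone_iff_succ_le.2 fun i => (P.step i).lt.le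

/-- The numeral `1` is read modulo `P.length + 1`: it is the second vertex only for positive length,
and `0` otherwise. -/
lemma QPath.one_covBy_head (P : QPath W) (hP : 0 < P.length) : P 1 ⋖ P.head := by
  have := P.step ⟨0, hP⟩
  have h1 : (⟨0, hP⟩ : Fin P.length).succ = 1 := by
    apply Fin.ext
    rw [Fin.val_succ, Fin.val_one', Nat.mod_eq_of_lt (by omega)]
  rwa [h1] at this

/-- A reflection negates every path which starts with the ambient space followed by its
hyperplane. -/
lemma pathAct_single_of_isReflectionIn [FiniteDimensional ℝ V] [Finite W] (k : Type*) [Field k]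
    (o : Orientations W) {P : QPath W} (hP : P.head = Flat.ambient W) (hl : 0 < P.length) {s : W}
    (hs : IsReflectionIn (s : V ≃ₗ[ℝ] V) (P 1).1) :
    pathAct k o s (Finsupp.single P 1) = -Finsupp.single P 1 := by
  have hone : ((1 : Fin (P.length + 1)) : ℕ) = 1 := by
    rw [Fin.val_one', Nat.mod_eq_of_lt (by omega)]
  -- Vertices decrease along the path, so from index `1` on they lie in the hyperplane fixed by `s`.
  have hfix : ∀ i : Fin (P.length + 1), 1 ≤ i → ∀ v ∈ (P i).1, (s : V ≃ₗ[ℝ] V) v = v :=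
    fun i hi v hv => (hs.mem_iff v).1 (P.antitone hi hv)
  have hhead : s • P.head = P.head := by rw [hP, Flat.smul_ambient]
  have himage : P.image s = P := by
    refine RelSeries.ext rfl ?_
    funext i
    change s • P i = P i
    rcases eq_or_ne i 0 with rfl | hi
    · exact hhead
    · exact Flat.smul_eq_of_forall_apply_eq
        (hfix i (Fin.le_def.2
          (hone.trans_le (Nat.one_le_iff_ne_zero.2 (Fin.val_ne_zero_iff.2 hi)))))
  have hlast : ∀ v ∈ P.last.1, (s : V ≃ₗ[ℝ] V) v = v := hfix (Fin.last _) (Fin.le_last 1)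
  rw [pathAct, Finsupp.linearCombination_single, one_smul, himage,
    sigma_eq_neg_one_of_isReflectionIn o (congrArg Subtype.val hP) hhead hs,
    sigma_eq_one_of_forall_apply_eq o (Flat.smul_eq_of_forall_apply_eq hlast) hlast]
  simp

end Paths

end FaceAlgebra

end

theorem mainTheorem12
    {V : Type*} [AddCommGroup V] [Module ℝ V] [FiniteDimensional ℝ V]
    (W : Subgroup (V ≃ₗ[ℝ] V)) [Finite W] (hW : IsGeneratedByReflections W)
    (k : Type*) [Field k] (hk : (Nat.card W : k) ≠ 0)
    (L : InvariantFamily W k) :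
    -- no arrows start at the orbit of the ambient space
    (∀ O : Flat.Orbits W, numArrows k L.eps (Flat.orbit W (Flat.ambient W)) O = 0) ∧
    -- the same for the quiver computed with any other complete system of idempotents
    (∀ {ι : Type*} [Fintype ι] (e : ι → invariants W k), IsCompleteSystem e →
      ∀ u : ι, Nonempty (Submodule.span (invariants W k) {e u} ≃ₗ[invariants W k]
          Submodule.span (invariants W k) {L.eps (Flat.orbit W (Flat.ambient W))}) →
        ∀ v : ι, numArrows k e u v = 0) ∧
    -- the reflection in the first hyperplane of a path from `V` negates the path
    (∀ (o : Orientations W) (P : QPath W), P.head = Flat.ambient W → 0 < P.length →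
      (∃! s : W, IsReflectionIn (s : V ≃ₗ[ℝ] V) (P 1).1) ∧
      ∀ s : W, IsReflectionIn (s : V ≃ₗ[ℝ] V) (P 1).1 →
        pathAct k o s (Finsupp.single P 1) = -Finsupp.single P 1) := by
  refine ⟨numArrows_eq_zero_of_jacobson_mul_eq_zero k _ L.jacobson_mul_eps_ambient,
    fun e _ u ⟨φ⟩ v => numArrows_eq_zero_of_jacobson_mul_eq_zero k e
      (jacobson_mul_eq_zero_of_equiv φ L.jacobson_mul_eps_ambient) v,
    fun o P hP hl => ⟨?_, fun s hs => pathAct_single_of_isReflectionIn k o hP hl hs⟩⟩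
  obtain ⟨s, hs, hsP⟩ := Flat.mem_arrangement_of_covBy_ambient (hP ▸ P.one_covBy_head hl)
  exact ⟨⟨s, hs⟩, hsP, fun t ht => Subtype.ext (ht.unique t.2 hs hsP)⟩
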